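/- Let $H$ be a complex Hilbert space with an orthonormal basis $E=(e_n)_{n\in\mathbb N}$ (so $H$ is separable and infinite dimensional). For $a\in B(H)$ put $a_{mk}=\langle a e_k,e_m\rangle$. For a permutation $\rho$ of $\mathbb N$ let $\pi(\rho)\in B(H)$ be the unitary with $\pi(\rho)e_n=e_{\rho(n)}$, and let $\pi(S_{\mathbb N})=\{\pi(\rho):\rho\in S_{\mathbb N}\}$ be the set of permutation matrices. Let $$\mathrm{DS}=\Big\{a\in B(H): a_{mk}\ge 0,\ \sum_{k}a_{mk}=\sum_{k}a_{km}=1 \text{ for all } m,k\Big\},$$ $$\mathrm{DSS}=\Big\{a\in B(H): a_{mk}\ge 0,\ \sum_{k}a_{mk}\le 1,\ \sum_{k}a_{km}\le 1\text{ for all } m,k\Big\}.$$ Let $B(H)_*$ be the predual of $B(H)$, i.e. the set of functionals $a\mapsto\sum_n\langle a\xi_n,\eta_n\rangle$ with $\sum_n\|\xi_n\|^2<\infty$ and $\sum_n\|\eta_n\|^2<\infty$. For a topology $\mathcal T$ on $B(H)$ write $\overline{\mathrm{co}}^{\mathcal T}S$ for the $\mathcal T$-closure of the convex hull of $S$. 1.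 $\overline{\mathrm{co}}^{\mathcal T}\pi(S_{\mathbb N})\neq\mathrm{DS}$ when $\mathcal T$ is any of the following nine topologies on $B(H)$: weak operator, ultraweak $\sigma(B(H),B(H)_*)$, strong operator, strong$^*$, ultrastrong, ultrastrong$^*$, Arens–Mackey $\tau(B(H),B(H)_*)$ (uniform convergence on the convex $\sigma(B(H)_*,B(H))$-compact subsets of $B(H)_*$), weak Banach $\sigma(B(H),B(H)^*)$, norm. In this sense Birkhoff's Problem 111 has no solution in the operator topologies. 2. $\overline{\mathrm{co}}^{\mathcal T}\pi(S_{\mathbb N})=\mathrm{DSS}$ when $\mathcal T$ is any of the first seven of these topologies (weak, ultraweak, strong, strong$^*$, ultrastrong, ultrastrong$^*$, Arens–Mackey), and more generally when $\mathcal T$ is any topology on $B(H)$ that is finer than the weak operator topology and coarser than the Arens–Mackey topology. -/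

import Mathlib

open Set Topology
open scoped ComplexOrder ENNReal InnerProductSpace

noncomputable section

namespace BirkhoffHull

variable {H : Type*} [NormedAddCommGroup H] [InnerProductSpace ℂ H] [CompleteSpace H]

/-! ### The standard representation and the sets of matrices -/

/-- The orthonormal basis `n ↦ e_{ρ n}`. -/
def reindexBasis (E : HilbertBasis ℕ ℂ H) (ρ : Equiv.Perm ℕ) : HilbertBasis ℕ ℂ H :=
  HilbertBasis.mk (v := fun n => E (ρ n)) (E.orthonormal.comp ρ ρ.injective) (by
    have h : Set.range (fun n => E (ρ n)) = Set.range E := ρ.surjective.range_comp E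
    rw [h, E.dense_span])

/-- The unitary operator `π(ρ)`, determined by `π(ρ) e_n = e_{ρ n}`. -/
def permUnitary (E : HilbertBasis ℕ ℂ H) (ρ : Equiv.Perm ℕ) : H ≃ₗᵢ[ℂ] H :=
  E.repr.trans (reindexBasis E ρ).repr.symm

theorem permUnitary_apply (E : HilbertBasis ℕ ℂ H) (ρ : Equiv.Perm ℕ) (n : ℕ) :
    permUnitary E ρ (E n) = E (ρ n) := by
  simp [permUnitary, reindexBasis, HilbertBasis.repr_self, HilbertBasis.repr_symm_single]

/-- `π(S_ℕ)`, the set of permutation matrices in `B(H)` with respect to the basis `E`. -/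
def permMatrices (E : HilbertBasis ℕ ℂ H) : Set (H →L[ℂ] H) :=
  Set.range fun ρ : Equiv.Perm ℕ => ((permUnitary E ρ).toContinuousLinearEquiv : H →L[ℂ] H)

/-- The matrix coefficient `a_{mk} = ⟨a e_k, e_m⟩` (Mathlib's inner product is linear in the
second variable). -/
def coeff (E : HilbertBasis ℕ ℂ H) (a : H →L[ℂ] H) (m k : ℕ) : ℂ :=
  ⟪E m, a (E k)⟫_ℂ

/-- The doubly stochastic matrices in `B(H)`. The order on `ℂ` is the one for which `0 ≤ z` means
that `z` is real and nonnegative. -/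
def DS (E : HilbertBasis ℕ ℂ H) : Set (H →L[ℂ] H) :=
  {a | (∀ m k, 0 ≤ coeff E a m k) ∧
    (∀ m, HasSum (fun k => coeff E a m k) 1) ∧
    (∀ m, HasSum (fun k => coeff E a k m) 1)}

/-- The doubly substochastic matrices in `B(H)`. -/
def DSS (E : HilbertBasis ℕ ℂ H) : Set (H →L[ℂ] H) :=
  {a | (∀ m k, 0 ≤ coeff E a m k) ∧
    (∀ m, Summable (fun k => coeff E a m k) ∧ ∑' k, coeff E a m k ≤ 1) ∧
    (∀ m, Summable (fun k => coeff E a k m) ∧ ∑' k, coeff E a k m ≤ 1)}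

/-! ### The nine operator topologies on `B(H)` -/

variable (H)

/-- The norm topology. -/
abbrev normTopology : TopologicalSpace (H →L[ℂ] H) :=
  inferInstance

/-- The weak Banach topology `σ(B(H), B(H)^*)`. -/
abbrev weakBanachTopology : TopologicalSpace (H →L[ℂ] H) :=
  TopologicalSpace.induced (toWeakSpace ℂ (H →L[ℂ] H)) inferInstance

/-- The weak operator topology. -/
abbrev weakTopology : TopologicalSpace (H →L[ℂ] H) :=
  TopologicalSpace.induced
    (ContinuousLinearMapWOT.ofCLM : (H →L[ℂ] H) → (H →WOT[ℂ] H)) inferInstance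

/-- The strong operator topology: pointwise convergence on `H`. -/
abbrev strongTopology : TopologicalSpace (H →L[ℂ] H) :=
  TopologicalSpace.induced (fun (a : H →L[ℂ] H) (x : H) => a x) inferInstance

/-- The strong* topology: pointwise convergence on `H` of operators and of their adjoints. -/
abbrev strongStarTopology : TopologicalSpace (H →L[ℂ] H) :=
  strongTopology H ⊓
    TopologicalSpace.induced (fun a : H →L[ℂ] H => ContinuousLinearMap.adjoint a)
      (strongTopology H)

/-- The square-summable sequences in `H`, with `‖ξ‖ ^ 2 = ∑ n, ‖ξ n‖ ^ 2`. -/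
abbrev SqSummable : Type _ := lp (fun _ : ℕ => H) 2

variable {H}

/-- The operator `a` applied to each term of a square-summable sequence. -/
def ampl (a : H →L[ℂ] H) (ξ : SqSummable H) : SqSummable H :=
  ⟨fun n => a (ξ n), by
    have h := (memℓp_gen_iff (p := 2) (by norm_num)).1 (lp.memℓp ξ)
    refine memℓp_gen (Summable.of_nonneg_of_le (fun n => by positivity) (fun n => ?_)
      (h.mul_left (‖a‖ ^ (2 : ℝ≥0∞).toReal)))
    rw [← Real.mul_rpow (norm_nonneg _) (norm_nonneg _)]
    exact Real.rpow_le_rpow (norm_nonneg _) (a.le_opNorm _) (by norm_num)⟩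

variable (H)

/-- The ultrastrong topology, given by the seminorms `a ↦ (∑ n, ‖a (ξ n)‖ ^ 2) ^ (1 / 2)` for
square-summable sequences `ξ` in `H`. -/
abbrev ultrastrongTopology : TopologicalSpace (H →L[ℂ] H) :=
  TopologicalSpace.induced (fun (a : H →L[ℂ] H) (ξ : SqSummable H) => ampl a ξ) inferInstance

/-- The ultrastrong* topology, given by the ultrastrong seminorms of operators and of their
adjoints. -/
abbrev ultrastrongStarTopology : TopologicalSpace (H →L[ℂ] H) :=
  ultrastrongTopology H ⊓
    TopologicalSpace.induced (fun a : H →L[ℂ] H => ContinuousLinearMap.adjoint a)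
      (ultrastrongTopology H)

/-- The predual `B(H)_*`, inside the dual of `B(H)`: the functionals
`a ↦ ∑ n, ⟨a (ξ n), η n⟩` for square-summable sequences `ξ`, `η` in `H`. -/
def predual : Set (WeakDual ℂ (H →L[ℂ] H)) :=
  {f | ∃ ξ η : SqSummable H, ∀ a : H →L[ℂ] H, HasSum (fun n => ⟪η n, a (ξ n)⟫_ℂ) (f a)}

/-- The ultraweak topology `σ(B(H), B(H)_*)`. -/
abbrev ultraweakTopology : TopologicalSpace (H →L[ℂ] H) :=
  TopologicalSpace.induced (fun (a : H →L[ℂ] H) (f : predual H) => f.1 a) inferInstance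

/-- The convex subsets of `B(H)_*` that are compact for `σ(B(H)_*, B(H))`. -/
def mackeyFamily : Set (Set (WeakDual ℂ (H →L[ℂ] H))) :=
  {K | K ⊆ predual H ∧ Convex ℝ K ∧ IsCompact K}

/-- The Arens-Mackey topology `τ(B(H), B(H)_*)`: uniform convergence on the convex
`σ(B(H)_*, B(H))`-compact subsets of `B(H)_*`. -/
abbrev mackeyTopology : TopologicalSpace (H →L[ℂ] H) :=
  TopologicalSpace.induced
    (fun a : H →L[ℂ] H =>
      UniformOnFun.ofFun (mackeyFamily H) (fun f : WeakDual ℂ (H →L[ℂ] H) => f a))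
    inferInstance

/-- The seven operator topologies from the weak one to the Arens-Mackey one. -/
def weakToMackeyTopologies : Set (TopologicalSpace (H →L[ℂ] H)) :=
  {weakTopology H, ultraweakTopology H, strongTopology H, strongStarTopology H,
    ultrastrongTopology H, ultrastrongStarTopology H, mackeyTopology H}

/-- The nine operator topologies. -/
def operatorTopologies : Set (TopologicalSpace (H →L[ℂ] H)) :=
  weakToMackeyTopologies H ∪ {weakBanachTopology H, normTopology H}

variable {H}

/-- The closed convex hull of `S` for the topology `τ`. -/
def closedHull (τ : TopologicalSpace (H →L[ℂ] H)) (S : Set (H →L[ℂ] H)) : Set (H →L[ℂ] H) :=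
  closure[τ] (convexHull ℝ S)

end BirkhoffHull

end

set_option linter.unusedSectionVars false

noncomputable section

namespace BirkhoffHull

variable {H : Type*} [NormedAddCommGroup H] [InnerProductSpace ℂ H] [CompleteSpace H]

/-! ### Matrix coefficients and doubly substochastic matrices -/

/-! `DSS` is cut out by inequalities between finite sums of coefficients, so it is convex and weakly
closed and contains every closed hull in question. Conversely, each N × N corner of a doubly
substochastic matrix sits in a 2N × 2N doubly stochastic one (`fromBlocks_mem_doublyStochastic`).
Birkhoff's finite theorem makes it the corner of a convex combination of permutations of ℕ. These
combinations have norm at most 1, so they converge weakly and then ultraweakly.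

The passage to the Arens-Mackey topology (`mem_closure_mackeyTopology`) uses Sion's minimax theorem:
on a compact convex set of functionals, pointwise approximation from a convex set becomes uniform.
The other topologies lie in between because an ultrastrong seminorm is a supremum over the image of
a weak* compact dual ball.

For the failure of `DS`, the zero operator is a norm limit of convex combinations. Split ℕ into m
infinite classes and let the i-th permutation send the complement of class i into it. Orthogonality
of the classes bounds the sum of the m unitaries by 2√m (`norm_sum_permUnitary_le`), so their
average has norm at most 2/√m. -/

theorem coeff_add (E : HilbertBasis ℕ ℂ H) (a b : H →L[ℂ] H) (m k : ℕ) :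
    coeff E (a + b) m k = coeff E a m k + coeff E b m k := by
  simp [coeff]

theorem coeff_smul (E : HilbertBasis ℕ ℂ H) (r : ℝ) (a : H →L[ℂ] H) (m k : ℕ) :
    coeff E (r • a) m k = r * coeff E a m k := by
  simp only [coeff, _root_.smul_apply]
  rw [← Complex.coe_smul, inner_smul_right]

theorem coeff_sum (E : HilbertBasis ℕ ℂ H) {ι : Type*} (s : Finset ι) (a : ι → H →L[ℂ] H)
    (m k : ℕ) : coeff E (∑ i ∈ s, a i) m k = ∑ i ∈ s, coeff E (a i) m k := by
  simp [coeff]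

theorem coeff_permUnitary (E : HilbertBasis ℕ ℂ H) (ρ : Equiv.Perm ℕ) (m k : ℕ) :
    coeff E ((permUnitary E ρ).toContinuousLinearEquiv : H →L[ℂ] H) m k =
      if m = ρ k then 1 else 0 := by
  have h : ((permUnitary E ρ).toContinuousLinearEquiv : H →L[ℂ] H) (E k) = E (ρ k) :=
    permUnitary_apply E ρ k
  rw [coeff, h, orthonormal_iff_ite.1 E.orthonormal]

/-- Bounded partial sums of nonnegative terms converge. The finite form involves finitely many
coefficients at a time, so it survives weak limits. -/
theorem summable_and_tsum_le_one_iff {f : ℕ → ℂ} (hf : ∀ k, 0 ≤ f k) :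
    (Summable f ∧ ∑' k, f k ≤ 1) ↔ ∀ s : Finset ℕ, ∑ k ∈ s, f k ≤ 1 := by
  constructor
  · rintro ⟨h1, h2⟩ s
    exact (h1.sum_le_tsum s fun k _ => hf k).trans h2
  · intro h
    have hre : ∀ k, f k = ((f k).re : ℂ) := fun k =>
      (Complex.eq_re_of_ofReal_le (r := 0) (by simpa using hf k))
    have hs : Summable f := by
      rw [funext hre, Complex.summable_ofReal]
      refine summable_of_sum_le (c := 1) (fun k => (Complex.le_def.1 (hf k)).1) fun s => ?_
      simpa using (Complex.le_def.1 (h s)).1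
    exact ⟨hs, hs.tsum_le_of_sum_le h⟩

theorem mem_DSS_iff {E : HilbertBasis ℕ ℂ H} {a : H →L[ℂ] H} :
    a ∈ DSS E ↔ (∀ m k, 0 ≤ coeff E a m k) ∧
      (∀ m (s : Finset ℕ), ∑ k ∈ s, coeff E a m k ≤ 1) ∧
      (∀ m (s : Finset ℕ), ∑ k ∈ s, coeff E a k m ≤ 1) := by
  refine and_congr_right fun h => and_congr ?_ ?_
  · exact forall_congr' fun m => summable_and_tsum_le_one_iff fun k => h m k
  · exact forall_congr' fun m => summable_and_tsum_le_one_iff fun k => h k m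

theorem convex_DSS (E : HilbertBasis ℕ ℂ H) : Convex ℝ (DSS E) := by
  intro a ha b hb s t hs ht hst
  rw [mem_DSS_iff] at ha hb ⊢
  have hs' : (0 : ℂ) ≤ s := by exact_mod_cast hs
  have ht' : (0 : ℂ) ≤ t := by exact_mod_cast ht
  have hst' : (s : ℂ) + t = 1 := by exact_mod_cast hst
  have key : ∀ x y : ℂ, x ≤ 1 → y ≤ 1 → (s : ℂ) * x + t * y ≤ 1 := fun x y hx hy =>
    (add_le_add (mul_le_mul_of_nonneg_left hx hs') (mul_le_mul_of_nonneg_left hy ht')).trans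
      (by simp [hst'])
  simp only [coeff_add, coeff_smul, Finset.sum_add_distrib, ← Finset.mul_sum]
  exact ⟨fun m k => add_nonneg (mul_nonneg hs' (ha.1 m k)) (mul_nonneg ht' (hb.1 m k)),
    fun m u => key _ _ (ha.2.1 m u) (hb.2.1 m u), fun m u => key _ _ (ha.2.2 m u) (hb.2.2 m u)⟩

theorem permMatrices_subset_DSS (E : HilbertBasis ℕ ℂ H) : permMatrices E ⊆ DSS E := by
  rintro _ ⟨ρ, rfl⟩
  rw [mem_DSS_iff]
  simp only [coeff_permUnitary]
  refine ⟨fun m k => by split_ifs <;> simp, fun m s => ?_, fun m s => ?_⟩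
  · have h : ∀ k, (m = ρ k) ↔ (ρ.symm m = k) := fun k => by
      rw [Equiv.symm_apply_eq]
    simp only [h, Finset.sum_ite_eq]
    split_ifs <;> simp
  · simp only [Finset.sum_ite_eq']
    split_ifs <;> simp

theorem convexHull_permMatrices_subset_DSS (E : HilbertBasis ℕ ℂ H) :
    convexHull ℝ (permMatrices E) ⊆ DSS E :=
  convexHull_min (permMatrices_subset_DSS E) (convex_DSS E)

theorem continuous_inner_weakTopology (x y : H) :
    Continuous[weakTopology H, inferInstance] fun a : H →L[ℂ] H => ⟪y, a x⟫_ℂ := by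
  let _ := weakTopology H
  exact (ContinuousLinearMapWOT.continuous_dual_apply x (innerSL ℂ y)).comp continuous_induced_dom

theorem isClosed_DSS (E : HilbertBasis ℕ ℂ H) : IsClosed[weakTopology H] (DSS E) := by
  let _ := weakTopology H
  have hc : ∀ m k, Continuous fun a : H →L[ℂ] H => coeff E a m k := fun m k =>
    continuous_inner_weakTopology (E k) (E m)
  have h : DSS E = (⋂ m, ⋂ k, {a | 0 ≤ coeff E a m k}) ∩
      ((⋂ m, ⋂ s : Finset ℕ, {a | ∑ k ∈ s, coeff E a m k ≤ 1}) ∩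
      (⋂ m, ⋂ s : Finset ℕ, {a | ∑ k ∈ s, coeff E a k m ≤ 1})) := by
    ext a
    rw [mem_DSS_iff]
    simp
  rw [h]
  refine IsClosed.inter ?_ (IsClosed.inter ?_ ?_)
  · exact isClosed_iInter fun m => isClosed_iInter fun k =>
      isClosed_le continuous_const (hc m k)
  · exact isClosed_iInter fun m => isClosed_iInter fun s =>
      isClosed_le (continuous_finsetSum _ fun k _ => hc m k) continuous_const
  · exact isClosed_iInter fun m => isClosed_iInter fun s =>
      isClosed_le (continuous_finsetSum _ fun k _ => hc k m) continuous_const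

/-- The unit ball is convex and contains the isometries. This uniform bound is what upgrades
agreement on corners to weak and ultraweak convergence. -/
theorem norm_le_one_of_mem_convexHull (E : HilbertBasis ℕ ℂ H) {c : H →L[ℂ] H}
    (hc : c ∈ convexHull ℝ (permMatrices E)) : ‖c‖ ≤ 1 := by
  have h : convexHull ℝ (permMatrices E) ⊆ Metric.closedBall 0 1 := by
    refine convexHull_min ?_ (convex_closedBall _ _)
    rintro _ ⟨ρ, rfl⟩
    rw [mem_closedBall_zero_iff]
    refine ContinuousLinearMap.opNorm_le_bound _ zero_le_one fun x => ?_
    rw [one_mul]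
    exact ((permUnitary E ρ).norm_map x).le
  exact mem_closedBall_zero_iff.1 (h hc)

/-! ### Corners of doubly substochastic matrices -/

open Matrix in
/-- A doubly substochastic matrix is a corner of a doubly stochastic one. -/
theorem fromBlocks_mem_doublyStochastic {n : Type*} [Fintype n] [DecidableEq n]
    {A : Matrix n n ℝ} (h0 : ∀ i j, 0 ≤ A i j) (hr : ∀ i, ∑ j, A i j ≤ 1)
    (hc : ∀ j, ∑ i, A i j ≤ 1) :
    fromBlocks A (diagonal fun i => 1 - ∑ j, A i j) (diagonal fun j => 1 - ∑ i, A i j) Aᵀ ∈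
      doublyStochastic ℝ (n ⊕ n) := by
  rw [mem_doublyStochastic_iff_sum]
  refine ⟨?_, ?_, ?_⟩
  · rintro (i | i) (j | j)
    · exact h0 i j
    · rw [fromBlocks_apply₁₂, diagonal_apply]
      split_ifs
      exacts [sub_nonneg.2 (hr i), le_rfl]
    · rw [fromBlocks_apply₂₁, diagonal_apply]
      split_ifs
      exacts [sub_nonneg.2 (hc i), le_rfl]
    · exact h0 j i
  -- An upper row is a row of `A` plus its deficit; a lower row is a column of `A` plus its deficit.
  · rintro (i | i) <;> simp [Fintype.sum_sum_type, diagonal_apply]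
  · rintro (i | i) <;> simp [Fintype.sum_sum_type, diagonal_apply]

/-- The upper left `N × N` corner of a doubly substochastic matrix is that of a convex
combination of permutation matrices. -/
theorem exists_mem_convexHull_coeff_eq {E : HilbertBasis ℕ ℂ H} {a : H →L[ℂ] H} (ha : a ∈ DSS E)
    (N : ℕ) : ∃ c ∈ convexHull ℝ (permMatrices E),
      ∀ m < N, ∀ k < N, coeff E c m k = coeff E a m k := by
  rw [mem_DSS_iff] at ha
  obtain ⟨h0, hr, hc⟩ := ha
  have hre : ∀ m k, ((coeff E a m k).re : ℂ) = coeff E a m k := fun m k =>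
    (Complex.eq_re_of_ofReal_le (r := 0) (by simpa using h0 m k)).symm
  let A : Matrix (Fin N) (Fin N) ℝ := fun i j => (coeff E a i j).re
  have hA := fromBlocks_mem_doublyStochastic (A := A)
    (fun i j => (Complex.le_def.1 (h0 i j)).1)
    (fun i => by
      have := (Complex.le_def.1 (hr i (Finset.range N))).1
      rw [Finset.sum_range] at this
      simpa [A] using this)
    (fun j => by
      have := (Complex.le_def.1 (hc j (Finset.range N))).1
      rw [Finset.sum_range] at this
      simpa [A] using this)
  obtain ⟨w, hw0, hw1, hw⟩ := exists_eq_sum_perm_of_mem_doublyStochastic hA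
  let f : Fin N ⊕ Fin N ↪ ℕ := (finSumFinEquiv.toEmbedding).trans Fin.valEmbedding
  have hf : ∀ i : Fin N, f (Sum.inl i) = i := fun i => by simp [f]
  -- The inverse reconciles conventions: `permMatrix` has its 1 where `σ i = j`, whereas `π(ρ)` has
  -- it where `m = ρ k`. Off the range of `f` the extension is the identity.
  let p : Equiv.Perm (Fin N ⊕ Fin N) → H →L[ℂ] H := fun σ =>
    ((permUnitary E (σ⁻¹.viaFintypeEmbedding f)).toContinuousLinearEquiv : H →L[ℂ] H)
  refine ⟨∑ σ, w σ • p σ, (convex_convexHull ℝ _).sum_mem (fun σ _ => hw0 σ) hw1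
    (fun σ _ => subset_convexHull ℝ _ ⟨_, rfl⟩), fun m hm k hk => ?_⟩
  have hp : ∀ σ, coeff E (p σ) m k =
      ((σ.permMatrix ℝ (Sum.inl ⟨m, hm⟩) (Sum.inl ⟨k, hk⟩) : ℝ) : ℂ) := by
    intro σ
    have e1 : m = f (Sum.inl ⟨m, hm⟩) := (hf ⟨m, hm⟩).symm
    have e2 : k = f (Sum.inl ⟨k, hk⟩) := (hf ⟨k, hk⟩).symm
    rw [coeff_permUnitary]
    conv_lhs => rw [e1, e2, Equiv.Perm.viaFintypeEmbedding_apply_image]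
    simp only [f.injective.eq_iff, Equiv.Perm.eq_inv_iff_eq, Equiv.Perm.permMatrix,
      PEquiv.toMatrix_apply, Equiv.toPEquiv_apply, Option.mem_def, Option.some.injEq]
    split_ifs <;> simp
  have hm' := congrFun (congrFun hw (Sum.inl ⟨m, hm⟩)) (Sum.inl ⟨k, hk⟩)
  rw [coeff_sum]
  simp only [coeff_smul, hp]
  rw [← hre m k]
  have : (coeff E a m k).re = A ⟨m, hm⟩ ⟨k, hk⟩ := rfl
  rw [this]
  rw [Matrix.fromBlocks_apply₁₁] at hm'
  rw [← hm', Matrix.sum_apply]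
  simp only [Matrix.smul_apply, smul_eq_mul, Complex.ofReal_mul, Complex.ofReal_sum]

/-! ### Convergence against functionals in the predual -/

/-- The truncation of `x` to the first `N` vectors of the basis. -/
def truncate (E : HilbertBasis ℕ ℂ H) (N : ℕ) (x : H) : H :=
  ∑ k ∈ Finset.range N, E.repr x k • E k

theorem tendsto_truncate (E : HilbertBasis ℕ ℂ H) (x : H) :
    Filter.Tendsto (fun N => truncate E N x) Filter.atTop (𝓝 x) :=
  (E.hasSum_repr x).tendsto_sum_nat

theorem inner_truncate_eq {E : HilbertBasis ℕ ℂ H} {a b : H →L[ℂ] H} {N : ℕ}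
    (h : ∀ m < N, ∀ k < N, coeff E a m k = coeff E b m k) (x y : H) :
    ⟪truncate E N y, a (truncate E N x)⟫_ℂ = ⟪truncate E N y, b (truncate E N x)⟫_ℂ := by
  simp only [truncate, map_sum, map_smul, sum_inner, inner_sum, inner_smul_left, inner_smul_right,
    Finset.mul_sum]
  refine Finset.sum_congr rfl fun k hk => Finset.sum_congr rfl fun m hm => ?_
  have := h _ (Finset.mem_range.1 hm) _ (Finset.mem_range.1 hk)
  simp only [coeff] at this
  rw [this]

/-- A bounded sequence of operators converges weakly if its corners are eventually constant. -/
theorem tendsto_inner_of_coeff_eq {E : HilbertBasis ℕ ℂ H} {a : H →L[ℂ] H} {c : ℕ → H →L[ℂ] H}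
    {C : ℝ} (hC : ∀ N, ‖c N‖ ≤ C)
    (h : ∀ N, ∀ m < N, ∀ k < N, coeff E (c N) m k = coeff E a m k) (x y : H) :
    Filter.Tendsto (fun N => ⟪y, c N x⟫_ℂ) Filter.atTop (𝓝 ⟪y, a x⟫_ℂ) := by
  have hx := tendsto_truncate E x
  have hy := tendsto_truncate E y
  have hx0 : Filter.Tendsto (fun N => ‖x - truncate E N x‖) Filter.atTop (𝓝 0) := by
    simpa using ((tendsto_const_nhds (x := x)).sub hx).norm
  have hy0 : Filter.Tendsto (fun N => ‖y - truncate E N y‖) Filter.atTop (𝓝 0) := by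
    simpa using ((tendsto_const_nhds (x := y)).sub hy).norm
  -- With truncations x' and y', ⟪y, c x⟫ = ⟪y - y', c x⟫ + ⟪y', c (x - x')⟫ + ⟪y', c x'⟫. The last
  -- term sees only the corner, where `c N` may be replaced by `a`.
  have h1 : Filter.Tendsto (fun N => ⟪truncate E N y, c N (truncate E N x)⟫_ℂ) Filter.atTop
      (𝓝 ⟪y, a x⟫_ℂ) := by
    simp only [fun N => inner_truncate_eq (h N) x y]
    exact hy.inner ((a.continuous.tendsto x).comp hx)
  have h2 : Filter.Tendsto (fun N => ⟪y - truncate E N y, c N x⟫_ℂ) Filter.atTop (𝓝 0) := by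
    refine squeeze_zero_norm (a := fun N => ‖y - truncate E N y‖ * (C * ‖x‖)) (fun N => ?_) ?_
    · exact (norm_inner_le_norm _ _).trans (mul_le_mul_of_nonneg_left
        ((c N).le_of_opNorm_le (hC N) x) (norm_nonneg _))
    · simpa using hy0.mul_const (C * ‖x‖)
  have h3 : Filter.Tendsto (fun N => ⟪truncate E N y, c N (x - truncate E N x)⟫_ℂ) Filter.atTop
      (𝓝 0) := by
    refine squeeze_zero_norm
      (a := fun N => ‖truncate E N y‖ * (C * ‖x - truncate E N x‖)) (fun N => ?_) ?_
    · exact (norm_inner_le_norm _ _).trans (mul_le_mul_of_nonneg_left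
        ((c N).le_of_opNorm_le (hC N) _) (norm_nonneg _))
    · simpa using hy.norm.mul (hx0.const_mul C)
  have h4 := (h2.add h3).add h1
  rw [zero_add, zero_add] at h4
  refine h4.congr fun N => ?_
  simp only [inner_sub_left, map_sub, inner_sub_right]
  ring

theorem summable_norm_mul_norm (ξ η : SqSummable H) : Summable fun n => ‖ξ n‖ * ‖η n‖ := by
  have h := fun ξ : SqSummable H => (memℓp_gen_iff (p := 2) (by norm_num)).1 (lp.memℓp ξ)
  refine Summable.of_nonneg_of_le (fun n => by positivity) (fun n => ?_) ((h ξ).add (h η))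
  simp only [ENNReal.toReal_ofNat, Real.rpow_two]
  nlinarith [sq_nonneg (‖ξ n‖ - ‖η n‖), sq_nonneg ‖ξ n‖, sq_nonneg ‖η n‖]

/-- On bounded sequences weak convergence implies ultraweak convergence. -/
theorem tendsto_predual_of_tendsto_inner {a : H →L[ℂ] H} {c : ℕ → H →L[ℂ] H} {C : ℝ}
    (hC : ∀ N, ‖c N‖ ≤ C)
    (h : ∀ x y, Filter.Tendsto (fun N => ⟪y, c N x⟫_ℂ) Filter.atTop (𝓝 ⟪y, a x⟫_ℂ))
    {φ : WeakDual ℂ (H →L[ℂ] H)} (hφ : φ ∈ predual H) :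
    Filter.Tendsto (fun N => φ (c N)) Filter.atTop (𝓝 (φ a)) := by
  obtain ⟨ξ, η, hφ⟩ := hφ
  simp only [fun b => ((hφ b).tsum_eq).symm]
  refine tendsto_tsum_of_dominated_convergence (bound := fun n => C * (‖ξ n‖ * ‖η n‖))
    ((summable_norm_mul_norm ξ η).mul_left C) (fun n => h _ _) (.of_forall fun N n => ?_)
  calc ‖⟪η n, c N (ξ n)⟫_ℂ‖ ≤ ‖η n‖ * (C * ‖ξ n‖) :=
        (norm_inner_le_norm _ _).trans (mul_le_mul_of_nonneg_left
          ((c N).le_of_opNorm_le (hC N) _) (norm_nonneg _))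
    _ = C * (‖ξ n‖ * ‖η n‖) := by ring

/-- Doubly substochastic matrices are ultraweak limits of convex combinations of permutation
matrices. -/
theorem exists_seq_tendsto_predual {E : HilbertBasis ℕ ℂ H} {a : H →L[ℂ] H} (ha : a ∈ DSS E) :
    ∃ c : ℕ → H →L[ℂ] H, (∀ N, c N ∈ convexHull ℝ (permMatrices E)) ∧
      ∀ φ ∈ predual H, Filter.Tendsto (fun N => φ (c N)) Filter.atTop (𝓝 (φ a)) := by
  choose c hc hca using exists_mem_convexHull_coeff_eq ha
  have hC := fun N => norm_le_one_of_mem_convexHull E (hc N)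
  exact ⟨c, hc, fun φ hφ =>
    tendsto_predual_of_tendsto_inner hC (tendsto_inner_of_coeff_eq hC hca) hφ⟩

/-! ### The predual and the Arens-Mackey topology -/

/-- The sequence `ξ 0, η 0, ξ 1, η 1, …`. -/
def interleave (ξ η : SqSummable H) : SqSummable H :=
  ⟨fun n => if Even n then ξ (n / 2) else η (n / 2), by
    have h := fun ξ : SqSummable H => (memℓp_gen_iff (p := 2) (by norm_num)).1 (lp.memℓp ξ)
    refine memℓp_gen (HasSum.even_add_odd (m := ∑' n, ‖ξ n‖ ^ (2 : ℝ≥0∞).toReal)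
      (m' := ∑' n, ‖η n‖ ^ (2 : ℝ≥0∞).toReal) ?_ ?_).summable
    · simpa using (h ξ).hasSum
    · have e : ∀ k, (2 * k + 1) / 2 = k := fun k => by omega
      simpa [e] using (h η).hasSum⟩

theorem interleave_two_mul (ξ η : SqSummable H) (n : ℕ) : interleave ξ η (2 * n) = ξ n := by
  simp [interleave]

theorem interleave_two_mul_add_one (ξ η : SqSummable H) (n : ℕ) :
    interleave ξ η (2 * n + 1) = η n := by
  have e : (2 * n + 1) / 2 = n := by omega
  simp [interleave, e]

theorem add_mem_predual {φ ψ : WeakDual ℂ (H →L[ℂ] H)} (hφ : φ ∈ predual H)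
    (hψ : ψ ∈ predual H) : φ + ψ ∈ predual H := by
  obtain ⟨ξ, η, h⟩ := hφ
  obtain ⟨ξ', η', h'⟩ := hψ
  refine ⟨interleave ξ ξ', interleave η η', fun a => HasSum.even_add_odd ?_ ?_⟩
  · simp only [interleave_two_mul]
    exact h a
  · simp only [interleave_two_mul_add_one]
    exact h' a

theorem smul_mem_predual (z : ℂ) {φ : WeakDual ℂ (H →L[ℂ] H)} (hφ : φ ∈ predual H) :
    z • φ ∈ predual H := by
  obtain ⟨ξ, η, h⟩ := hφ
  refine ⟨z • ξ, η, fun a => ?_⟩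
  simp only [lp.coeFn_smul, Pi.smul_apply, map_smul, inner_smul_right]
  exact (h a).mul_left z

theorem convex_predual : Convex ℝ (predual H) := by
  intro φ hφ ψ hψ s t _ _ _
  exact add_mem_predual (smul_mem_predual (s : ℂ) hφ) (smul_mem_predual (t : ℂ) hψ)

/-! ### Compact convex sets of functionals and minimax -/

theorem isCompact_convexJoin {V : Type*} [AddCommGroup V] [Module ℝ V] [TopologicalSpace V]
    [IsTopologicalAddGroup V] [hV : ContinuousSMul ℝ V] {s t : Set V} (hs : IsCompact s)
    (ht : IsCompact t) : IsCompact (convexJoin ℝ s t) := by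
  have h : convexJoin ℝ s t =
      (fun p : ℝ × V × V => AffineMap.lineMap p.2.1 p.2.2 p.1) '' (Icc 0 1 ×ˢ s ×ˢ t) := by
    ext x
    simp only [mem_convexJoin, segment_eq_image_lineMap, mem_image, Prod.exists, mem_prod]
    constructor
    · rintro ⟨y, hy, z, hz, r, hr, rfl⟩
      exact ⟨r, y, z, ⟨hr, hy, hz⟩, rfl⟩
    · rintro ⟨r, y, z, ⟨hr, hy, hz⟩, rfl⟩
      exact ⟨y, hy, z, hz, r, hr, rfl⟩
  rw [h]
  refine (isCompact_Icc.prod (hs.prod ht)).image ?_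
  simp only [AffineMap.lineMap_apply_module]
  fun_prop

/-- A union need not be convex, so the join serves as upper bound; it is empty if either factor is,
hence the case split. Directedness is what gives the topology of uniform convergence its usual
neighbourhood basis. -/
theorem directedOn_mackeyFamily : DirectedOn (· ⊆ ·) (mackeyFamily H) := by
  intro K hK L hL
  rcases K.eq_empty_or_nonempty with rfl | hK0
  · exact ⟨L, hL, empty_subset L, subset_rfl⟩
  rcases L.eq_empty_or_nonempty with rfl | hL0
  · exact ⟨K, hK, subset_rfl, empty_subset K⟩
  refine ⟨convexJoin ℝ K L, ⟨?_, hK.2.1.convexJoin hL.2.1, isCompact_convexJoin (hV := WeakDual.instContinuousSMul ℝ) hK.2.2 hL.2.2⟩,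
    subset_convexJoin_left hL0, subset_convexJoin_right hK0⟩
  exact (convexJoin_subset_convexHull K L).trans
    (convexHull_min (union_subset hK.1 hL.1) convex_predual)

theorem smul_mem_mackeyFamily (z : ℂ) {K : Set (WeakDual ℂ (H →L[ℂ] H))}
    (hK : K ∈ mackeyFamily H) : (fun φ => z • φ) '' K ∈ mackeyFamily H := by
  refine ⟨?_, ?_, hK.2.2.image (continuous_const_smul z)⟩
  · rintro _ ⟨φ, hφ, rfl⟩
    exact smul_mem_predual z (hK.1 hφ)
  · rintro _ ⟨φ, hφ, rfl⟩ _ ⟨ψ, hψ, rfl⟩ s t hs ht hst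
    refine ⟨s • φ + t • ψ, hK.2.1 hφ hψ hs ht hst, ?_⟩
    refine DFunLike.ext _ _ fun a => ?_
    change z * (s * φ a + t * ψ a) = s * (z * φ a) + t * (z * ψ a)
    ring

theorem singleton_mem_mackeyFamily {φ : WeakDual ℂ (H →L[ℂ] H)} (hφ : φ ∈ predual H) :
    {φ} ∈ mackeyFamily H := by
  refine ⟨singleton_subset_iff.2 hφ, ?_, isCompact_singleton⟩
  rintro _ rfl _ rfl s t _ _ hst
  refine DFunLike.ext _ _ fun a => ?_
  change (s : ℂ) * _ + (t : ℂ) * _ = _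
  rw [← add_mul, ← Complex.ofReal_add, hst, Complex.ofReal_one, one_mul]
  rfl

theorem mackeyFamily_nonempty : (mackeyFamily H).Nonempty :=
  ⟨∅, empty_subset _, convex_empty, isCompact_empty⟩

/-- Every member of the Mackey family is contained, with its multiples by `-1`, `I` and `-I`, in
another one. -/
theorem exists_mackeyFamily_superset {K : Set (WeakDual ℂ (H →L[ℂ] H))}
    (hK : K ∈ mackeyFamily H) : ∃ L ∈ mackeyFamily H,
      ∀ φ ∈ K, φ ∈ L ∧ (-1 : ℂ) • φ ∈ L ∧ Complex.I • φ ∈ L ∧ (-Complex.I) • φ ∈ L := by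
  obtain ⟨L₁, hL₁, h1, h2⟩ := directedOn_mackeyFamily K hK _ (smul_mem_mackeyFamily (-1) hK)
  obtain ⟨L, hL, h3, h4⟩ :=
    directedOn_mackeyFamily L₁ hL₁ _ (smul_mem_mackeyFamily Complex.I hL₁)
  refine ⟨L, hL, fun φ hφ => ⟨h3 (h1 hφ), h3 (h2 ⟨φ, hφ, rfl⟩), h4 ⟨φ, h1 hφ, rfl⟩,
    h4 ⟨(-1 : ℂ) • φ, h2 ⟨φ, hφ, rfl⟩, ?_⟩⟩⟩
  simp only [smul_smul, mul_neg, mul_one]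

/-- A form of the minimax theorem: if for each `x` in a compact convex set `X` some `y` in a
convex set `Y` satisfies `t < f x y`, then one `y` does so for all `x`. -/
theorem exists_forall_lt_of_isCompact {V W : Type*} [AddCommGroup V] [Module ℝ V]
    [TopologicalSpace V] [IsTopologicalAddGroup V] [hV : ContinuousSMul ℝ V] [AddCommGroup W]
    [Module ℝ W] [TopologicalSpace W] [IsTopologicalAddGroup W] [ContinuousSMul ℝ W]
    {X : Set V} {Y : Set W} (hX : Convex ℝ X) (hXk : IsCompact X) (hY : Convex ℝ Y)
    (hY0 : Y.Nonempty) {f : V → W → ℝ} (hf₁ : ∀ y, Continuous fun x => f x y)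
    (hf₂ : ∀ x, Continuous (f x)) (hf₃ : ∀ y, ConvexOn ℝ X fun x => f x y)
    (hf₄ : ∀ x, ConcaveOn ℝ Y (f x)) {t : ℝ} (h : ∀ x ∈ X, ∃ y ∈ Y, t < f x y) :
    ∃ y ∈ Y, ∀ x ∈ X, t < f x y := by
  rcases X.eq_empty_or_nonempty with rfl | hX0
  · obtain ⟨y, hy⟩ := hY0
    exact ⟨y, hy, by simp⟩
  choose! g hgY hg using h
  -- Each `g x` still works near `x`, so finitely many values of `g` serve all of `X`; Sion's
  -- theorem is applied in this finite form.
  obtain ⟨s, hsX, hs⟩ := hXk.elim_nhds_subcover (fun x => {z | t < f z (g x)})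
    (fun x hx => (isOpen_lt continuous_const (hf₁ (g x))).mem_nhds (hg x hx))
  refine Sion.exists_lt_iInf_of_lt_iInf_of_finite hX0 hXk
    (fun y _ => (hf₁ y).lowerSemicontinuous.lowerSemicontinuousOn _)
    (fun y _ => (hf₃ y).quasiconvexOn) hY
    (fun x _ => (hf₂ x).upperSemicontinuous.upperSemicontinuousOn _)
    (fun x _ => (hf₄ x).quasiconcaveOn) hX (s.finite_toSet.image g) ?_ ?_
  · rintro _ ⟨x, hx, rfl⟩
    exact hgY x (hsX x hx)
  · intro x hx
    obtain ⟨z, hz, h⟩ := mem_iUnion₂.1 (hs hx)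
    exact ⟨g z, ⟨z, hz, rfl⟩, h⟩

/-- On a compact convex set of functionals, the pointwise approximations of an operator by members
of a convex set can be made uniform. -/
theorem exists_forall_lt_re {L : Set (WeakDual ℂ (H →L[ℂ] H))} (hLc : Convex ℝ L)
    (hLk : IsCompact L) {C : Set (H →L[ℂ] H)} (hC : Convex ℝ C) (hC0 : C.Nonempty)
    {a : H →L[ℂ] H} {t : ℝ} (h : ∀ φ ∈ L, ∃ c ∈ C, t < (φ (c - a)).re) :
    ∃ c ∈ C, ∀ φ ∈ L, t < (φ (c - a)).re := by
  refine exists_forall_lt_of_isCompact (hV := WeakDual.instContinuousSMul ℝ) hLc hLk hC hC0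
    (f := fun (φ : WeakDual ℂ (H →L[ℂ] H)) c => (φ (c - a)).re)
    (fun c => Complex.continuous_re.comp (WeakDual.eval_continuous (c - a)))
    (fun φ => Complex.continuous_re.comp
      (φ.continuous.comp (continuous_id.sub continuous_const)))
    (fun c => ⟨hLc, fun φ _ ψ _ u v _ _ _ => le_of_eq ?_⟩)
    (fun φ => ⟨hC, fun b _ c _ u v _ _ huv => le_of_eq ?_⟩) h
  · change (u * φ (c - a) + v * ψ (c - a)).re = u * (φ (c - a)).re + v * (ψ (c - a)).re
    simp
  · have h1 : u • b + v • c - a = (u : ℂ) • (b - a) + (v : ℂ) • (c - a) := by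
      have h2 : a = (u : ℂ) • a + (v : ℂ) • a := by
        rw [← add_smul, ← Complex.ofReal_add, huv, Complex.ofReal_one, one_smul]
      rw [← Complex.coe_smul, ← Complex.coe_smul, smul_sub, smul_sub]
      nth_rewrite 1 [h2]
      abel
    beta_reduce
    rw [h1, map_add, map_smul, map_smul]
    simp

/-- A convex set has the same closure for the Arens-Mackey topology as for the ultraweak one. -/
theorem mem_closure_mackeyTopology {C : Set (H →L[ℂ] H)} (hC : Convex ℝ C) (hC0 : C.Nonempty)
    {a : H →L[ℂ] H} (h : ∀ φ ∈ predual H, ∀ ε > 0, ∃ c ∈ C, -ε < (φ (c - a)).re) :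
    a ∈ closure[mackeyTopology H] C := by
  rw [closure_induced, mem_closure_iff_nhds_basis (UniformOnFun.hasBasis_nhds_of_basis _ _ _ _
    mackeyFamily_nonempty directedOn_mackeyFamily Metric.uniformity_basis_dist)]
  rintro ⟨K, ε⟩ ⟨hK, hε⟩
  obtain ⟨L, hL, hKL⟩ := exists_mackeyFamily_superset hK
  obtain ⟨c, hc, hcL⟩ := exists_forall_lt_re hL.2.1 hL.2.2 hC hC0
    (fun φ hφ => h φ (hL.1 hφ) (ε / 2) (half_pos hε))
  refine ⟨_, ⟨c, hc, rfl⟩, fun φ hφ => ?_⟩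
  -- Lower bounds on the real parts for the multiples by 1, -1, I and -I bound both the real and the
  -- imaginary part in absolute value.
  obtain ⟨h1, h2, h3, h4⟩ := hKL φ hφ
  replace h1 := hcL _ h1
  replace h2 := hcL _ h2
  replace h3 := hcL _ h3
  replace h4 := hcL _ h4
  have e : ∀ z : ℂ, (z • φ : WeakDual ℂ (H →L[ℂ] H)) (c - a) = z * φ (c - a) := fun z => rfl
  rw [e] at h2 h3 h4
  simp only [Complex.mul_re, Complex.neg_re, Complex.one_re, Complex.neg_im, Complex.one_im,
    Complex.I_re, Complex.I_im] at h2 h3 h4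
  change dist (φ c) (φ a) < ε
  rw [dist_eq_norm, ← map_sub]
  refine (Complex.norm_le_abs_re_add_abs_im _).trans_lt ?_
  have h5 : |(φ (c - a)).re| < ε / 2 := abs_lt.2 ⟨h1, by linarith⟩
  have h6 : |(φ (c - a)).im| < ε / 2 := abs_lt.2 ⟨by linarith, by linarith⟩
  linarith

theorem DSS_subset_closure_mackeyTopology (E : HilbertBasis ℕ ℂ H) :
    DSS E ⊆ closure[mackeyTopology H] (convexHull ℝ (permMatrices E)) := by
  intro a ha
  obtain ⟨c, hc, hlim⟩ := exists_seq_tendsto_predual ha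
  refine mem_closure_mackeyTopology (convex_convexHull ℝ _) ⟨c 0, hc 0⟩ fun φ hφ ε hε => ?_
  have h : Filter.Tendsto (fun N => (φ (c N - a)).re) Filter.atTop (𝓝 0) := by
    simp only [map_sub]
    have h1 := (hlim φ hφ).sub_const (φ a)
    rw [sub_self] at h1
    simpa [Function.comp_def] using (Complex.continuous_re.tendsto _).comp h1
  obtain ⟨N, hN⟩ := (h.eventually_const_lt (neg_lt_zero.2 hε)).exists
  exact ⟨c N, hc N, hN⟩

/-! ### Comparison of the operator topologies -/

/-- A map is Arens-Mackey continuous if its variation is controlled by that of the functionals in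
a member of the Mackey family. -/
theorem continuous_mackeyTopology {X : Type*} [PseudoMetricSpace X] {T : (H →L[ℂ] H) → X}
    {K : Set (WeakDual ℂ (H →L[ℂ] H))} (hK : K ∈ mackeyFamily H)
    (hT : ∀ a b, ∀ ε > 0, (∀ φ ∈ K, dist (φ a) (φ b) < ε) → dist (T a) (T b) ≤ ε) :
    Continuous[mackeyTopology H, inferInstance] T := by
  let _ := mackeyTopology H
  rw [continuous_iff_continuousAt]
  intro a
  rw [ContinuousAt, Metric.tendsto_nhds]
  intro ε hε
  rw [nhds_induced]
  refine ⟨_, UniformOnFun.gen_mem_nhds ℂ (mackeyFamily H) _ hK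
    (Metric.dist_mem_uniformity (half_pos hε)), fun b hb => ?_⟩
  have h := hT a b (ε / 2) (half_pos hε) fun φ hφ => hb φ hφ
  rw [mem_ofPred_eq, dist_comm]
  linarith

theorem mackeyTopology_le_ultraweakTopology : mackeyTopology H ≤ ultraweakTopology H := by
  rw [← continuous_iff_le_induced]
  let _ := mackeyTopology H
  refine continuous_pi fun f => continuous_mackeyTopology (singleton_mem_mackeyFamily f.2) ?_
  exact fun a b ε _ h => (h f.1 rfl).le

/-! ### Ultrastrong seminorms and the Arens-Mackey topology -/

theorem norm_ampl_le (a : H →L[ℂ] H) (ξ : SqSummable H) : ‖ampl a ξ‖ ≤ ‖a‖ * ‖ξ‖ := by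
  have h2 : (0 : ℝ) < (2 : ℝ≥0∞).toReal := by norm_num
  refine lp.norm_le_of_forall_sum_le h2 (by positivity) fun s => ?_
  rw [Real.mul_rpow (norm_nonneg _) (norm_nonneg _)]
  calc ∑ i ∈ s, ‖ampl a ξ i‖ ^ (2 : ℝ≥0∞).toReal
      ≤ ∑ i ∈ s, ‖a‖ ^ (2 : ℝ≥0∞).toReal * ‖ξ i‖ ^ (2 : ℝ≥0∞).toReal :=
        Finset.sum_le_sum fun i _ => by
          rw [← Real.mul_rpow (norm_nonneg _) (norm_nonneg _)]
          exact Real.rpow_le_rpow (norm_nonneg _) (a.le_opNorm _) h2.le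
    _ ≤ _ := by
        rw [← Finset.mul_sum]
        exact mul_le_mul_of_nonneg_left (lp.sum_rpow_le_norm_rpow h2 ξ s) (by positivity)

/-- The map `a ↦ ampl a ξ` as a continuous linear map. -/
def amplCLM (ξ : SqSummable H) : (H →L[ℂ] H) →L[ℂ] SqSummable H :=
  LinearMap.mkContinuous
    { toFun := fun a => ampl a ξ
      map_add' := fun _ _ => rfl
      map_smul' := fun _ _ => rfl } ‖ξ‖ fun a => by
        rw [mul_comm]
        exact norm_ampl_le a ξ

/-- A map into the square-summable sequences is Arens-Mackey continuous if its compositions with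
bounded functionals are, up to an isometry, functionals in the predual. -/
theorem continuous_mackeyTopology_of_dual {T : (H →L[ℂ] H) → SqSummable H}
    (Ψ : WeakDual ℂ (SqSummable H) → WeakDual ℂ (H →L[ℂ] H)) (hΨ : Continuous Ψ)
    (hpre : ∀ ψ, Ψ ψ ∈ predual H)
    (hlin : ∀ (s t : ℝ) ψ χ a, Ψ (s • ψ + t • χ) a = s * Ψ ψ a + t * Ψ χ a)
    (hT : ∀ ψ a b, dist (Ψ ψ a) (Ψ ψ b) = ‖ψ (T a - T b)‖) :
    Continuous[mackeyTopology H, inferInstance] T := by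
  -- The dual unit ball is weak* compact by Banach-Alaoglu and norms every vector by Hahn-Banach, so
  -- `Ψ '' B` is a Mackey set controlling `T`.
  let B : Set (WeakDual ℂ (SqSummable H)) := WeakDual.toStrongDual ⁻¹' Metric.closedBall 0 1
  have hB : IsCompact B := WeakDual.isCompact_closedBall 0 1
  have hBc : ∀ ψ ∈ B, ∀ χ ∈ B, ∀ s t : ℝ, 0 ≤ s → 0 ≤ t → s + t = 1 → s • ψ + t • χ ∈ B :=
    fun ψ hψ χ hχ s t hs ht hst =>
      convex_closedBall (0 : StrongDual ℂ (SqSummable H)) 1 hψ hχ hs ht hst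
  refine continuous_mackeyTopology (K := Ψ '' B) ⟨?_, ?_, hB.image hΨ⟩ ?_
  · rintro _ ⟨ψ, -, rfl⟩
    exact hpre ψ
  · rintro _ ⟨ψ, hψ, rfl⟩ _ ⟨χ, hχ, rfl⟩ s t hs ht hst
    exact ⟨_, hBc ψ hψ χ hχ s t hs ht hst, DFunLike.ext _ _ fun a => hlin s t ψ χ a⟩
  · intro a b ε _ h
    obtain ⟨g, hg, hgT⟩ := exists_dual_vector'' ℂ (T a - T b)
    have h1 := h _ ⟨StrongDual.toWeakDual g, mem_closedBall_zero_iff.2 hg, rfl⟩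
    rw [hT] at h1
    have h2 : StrongDual.toWeakDual g (T a - T b) = g (T a - T b) := rfl
    rw [h2, hgT, RCLike.norm_ofReal, abs_norm] at h1
    rw [dist_eq_norm]
    exact h1.le

/-- Riesz representation in ℓ²(H); the representing sequence is one of the two that place `a ↦ ψ
(ampl a ξ)` in the predual. -/
theorem hasSum_dual_apply (ψ : StrongDual ℂ (SqSummable H)) (v : SqSummable H) :
    HasSum (fun n => ⟪(InnerProductSpace.toDual ℂ (SqSummable H)).symm ψ n, v n⟫_ℂ) (ψ v) := by
  have h := lp.hasSum_inner (𝕜 := ℂ) ((InnerProductSpace.toDual ℂ (SqSummable H)).symm ψ) v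
  rwa [InnerProductSpace.toDual_symm_apply] at h

theorem continuous_ampl_mackeyTopology (ξ : SqSummable H) :
    Continuous[mackeyTopology H, inferInstance] fun a : H →L[ℂ] H => ampl a ξ := by
  refine continuous_mackeyTopology_of_dual
    (fun ψ => StrongDual.toWeakDual ((WeakDual.toStrongDual ψ).comp (amplCLM ξ))) ?_ ?_ ?_ ?_
  · exact WeakDual.continuous_of_continuous_eval fun a => WeakDual.eval_continuous (ampl a ξ)
  · exact fun ψ => ⟨ξ, _, fun a => hasSum_dual_apply (WeakDual.toStrongDual ψ) (ampl a ξ)⟩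
  · exact fun s t ψ χ a => rfl
  · intro ψ a b
    rw [dist_eq_norm, map_sub]
    rfl

theorem mackeyTopology_le_ultrastrongTopology : mackeyTopology H ≤ ultrastrongTopology H := by
  rw [← continuous_iff_le_induced]
  let _ := mackeyTopology H
  exact continuous_pi fun ξ => continuous_ampl_mackeyTopology ξ

/-- Composing `ψ` with the adjoint is conjugate-linear in `a`. A further conjugation restores
linearity without changing distances, and exchanges the roles of `ξ` and the Riesz vector. -/
theorem continuous_adjoint_mackeyTopology (ξ : SqSummable H) :
    Continuous[mackeyTopology H, inferInstance]
      fun a : H →L[ℂ] H => ampl (ContinuousLinearMap.adjoint a) ξ := by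
  let adj : (H →L[ℂ] H) →L⋆[ℂ] (H →L[ℂ] H) :=
    (ContinuousLinearMap.adjoint (𝕜 := ℂ) (E := H) (F := H)).toContinuousLinearEquiv
  let conj : ℂ →L⋆[ℂ] ℂ := (starL ℂ : ℂ ≃L⋆[ℂ] ℂ)
  let Ψ : WeakDual ℂ (SqSummable H) → WeakDual ℂ (H →L[ℂ] H) := fun ψ =>
    StrongDual.toWeakDual (conj.comp (((WeakDual.toStrongDual ψ).comp (amplCLM ξ)).comp adj))
  have hΨ : ∀ ψ a, Ψ ψ a = starRingEnd ℂ (ψ (ampl (ContinuousLinearMap.adjoint a) ξ)) :=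
    fun ψ a => rfl
  refine continuous_mackeyTopology_of_dual Ψ ?_ ?_ ?_ ?_
  · refine WeakDual.continuous_of_continuous_eval fun a => ?_
    simp only [hΨ]
    exact Complex.continuous_conj.comp (WeakDual.eval_continuous _)
  · refine fun ψ => ⟨(InnerProductSpace.toDual ℂ (SqSummable H)).symm (WeakDual.toStrongDual ψ), ξ,
      fun a => ?_⟩
    have h : HasSum _ (ψ (ampl (ContinuousLinearMap.adjoint a) ξ)) :=
      hasSum_dual_apply (WeakDual.toStrongDual ψ) _
    rw [hΨ]
    convert Complex.hasSum_conj'.2 h using 2 with n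
    rw [inner_conj_symm]
    exact (ContinuousLinearMap.adjoint_inner_left a _ _).symm
  · intro s t ψ χ a
    simp only [hΨ]
    change starRingEnd ℂ (s * _ + t * _) = _
    rw [map_add, map_mul, map_mul, Complex.conj_ofReal, Complex.conj_ofReal]
    rfl
  · intro ψ a b
    rw [hΨ, hΨ, dist_eq_norm, ← map_sub, RCLike.norm_conj, ← map_sub]

theorem mackeyTopology_le_ultrastrongStarTopology :
    mackeyTopology H ≤ ultrastrongStarTopology H := by
  refine le_inf mackeyTopology_le_ultrastrongTopology ?_
  rw [induced_compose, ← continuous_iff_le_induced]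
  let _ := mackeyTopology H
  exact continuous_pi fun ξ => continuous_adjoint_mackeyTopology ξ

/-- The sequence `x, 0, 0, …`. -/
def firstTerm (x : H) : SqSummable H := lp.single 2 0 x

theorem firstTerm_zero (x : H) : firstTerm x 0 = x := by
  simp [firstTerm]

theorem firstTerm_of_ne (x : H) {n : ℕ} (hn : n ≠ 0) : firstTerm x n = 0 := by
  simp [firstTerm, hn]

theorem ultrastrongTopology_le_strongTopology : ultrastrongTopology H ≤ strongTopology H := by
  rw [← continuous_iff_le_induced]
  let _ := ultrastrongTopology H
  refine continuous_pi fun x => ?_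
  have h0 : Continuous fun (a : H →L[ℂ] H) (ξ : SqSummable H) => ampl a ξ :=
    continuous_induced_dom
  have h1 : Continuous fun a : H →L[ℂ] H => ampl a (firstTerm x) :=
    continuous_pi_iff.1 h0 (firstTerm x)
  have h2 : Continuous fun v : SqSummable H => v 0 :=
    (LipschitzWith.of_dist_le_mul (K := 1) fun v w => by
      simpa [dist_eq_norm] using lp.norm_apply_le_norm two_ne_zero (v - w) 0).continuous
  have h3 : ∀ a : H →L[ℂ] H, ampl a (firstTerm x) 0 = a x := fun a => by
    change a (firstTerm x 0) = a x
    rw [firstTerm_zero]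
  exact (h2.comp h1).congr h3

theorem ultrastrongStarTopology_le_strongStarTopology :
    ultrastrongStarTopology H ≤ strongStarTopology H :=
  inf_le_inf ultrastrongTopology_le_strongTopology
    (induced_mono ultrastrongTopology_le_strongTopology)

theorem le_weakTopology {τ : TopologicalSpace (H →L[ℂ] H)}
    (h : ∀ (x : H) (y : StrongDual ℂ H), Continuous[τ, inferInstance] fun a => y (a x)) :
    τ ≤ weakTopology H := by
  rw [← continuous_iff_le_induced]
  exact ContinuousLinearMapWOT.continuous_of_dual_apply_continuous h

theorem strongTopology_le_weakTopology : strongTopology H ≤ weakTopology H := by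
  refine le_weakTopology fun x y => ?_
  let _ := strongTopology H
  exact y.continuous.comp ((continuous_apply x).comp continuous_induced_dom)

theorem ultraweakTopology_le_weakTopology : ultraweakTopology H ≤ weakTopology H := by
  refine le_weakTopology fun x y => ?_
  let φ : WeakDual ℂ (H →L[ℂ] H) :=
    StrongDual.toWeakDual (y.comp (ContinuousLinearMap.apply ℂ H x))
  have hφ : φ ∈ predual H := by
    refine ⟨firstTerm x, firstTerm ((InnerProductSpace.toDual ℂ H).symm y), fun a => ?_⟩
    have h := hasSum_single (f := fun n =>
      ⟪firstTerm ((InnerProductSpace.toDual ℂ H).symm y) n, a (firstTerm x n)⟫_ℂ) 0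
      fun n hn => by rw [firstTerm_of_ne _ hn, inner_zero_left]
    rw [firstTerm_zero, firstTerm_zero, InnerProductSpace.toDual_symm_apply] at h
    exact h
  let _ := ultraweakTopology H
  have h : Continuous fun (a : H →L[ℂ] H) (f : predual H) => f.1 a := continuous_induced_dom
  exact continuous_pi_iff.1 h ⟨φ, hφ⟩

theorem between_of_mem_weakToMackeyTopologies {τ : TopologicalSpace (H →L[ℂ] H)}
    (hτ : τ ∈ weakToMackeyTopologies H) : mackeyTopology H ≤ τ ∧ τ ≤ weakTopology H := by
  have h1 := mackeyTopology_le_ultrastrongStarTopology (H := H)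
  have h2 : ultrastrongStarTopology H ≤ ultrastrongTopology H := inf_le_left
  have h3 : strongStarTopology H ≤ strongTopology H := inf_le_left
  have h4 := ultrastrongTopology_le_strongTopology (H := H)
  have h5 := ultrastrongStarTopology_le_strongStarTopology (H := H)
  have h6 := strongTopology_le_weakTopology (H := H)
  have h7 := mackeyTopology_le_ultraweakTopology (H := H)
  have h8 := ultraweakTopology_le_weakTopology (H := H)
  rcases hτ with rfl | rfl | rfl | rfl | rfl | rfl | rfl
  · exact ⟨h7.trans h8, le_rfl⟩
  · exact ⟨h7, h8⟩
  · exact ⟨h1.trans (h5.trans h3), h6⟩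
  · exact ⟨h1.trans h5, h3.trans h6⟩
  · exact ⟨h1.trans h2, h4.trans h6⟩
  · exact ⟨h1, h2.trans (h4.trans h6)⟩
  · exact ⟨le_rfl, h7.trans h8⟩

theorem closedHull_permMatrices_eq_DSS (E : HilbertBasis ℕ ℂ H)
    {τ : TopologicalSpace (H →L[ℂ] H)} (h1 : mackeyTopology H ≤ τ) (h2 : τ ≤ weakTopology H) :
    closedHull τ (permMatrices E) = DSS E := by
  refine Subset.antisymm ?_ ((DSS_subset_closure_mackeyTopology E).trans (closure.mono h1))
  exact (@closure_minimal _ τ _ _ (convexHull_permMatrices_subset_DSS E)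
    ((isClosed_DSS E).mono h2))

/-! ### The zero operator is in the norm closed convex hull of the permutation matrices -/

/-- Both sets are countably infinite; the permutation swaps them along a bijection. -/
theorem exists_perm_mapsTo_compl {S : Set ℕ} (hS : S.Infinite) (hSc : Sᶜ.Infinite) :
    ∃ ρ : Equiv.Perm ℕ, ∀ n, n ∉ S → ρ n ∈ S := by
  classical
  have := hS.to_subtype
  have := hSc.to_subtype
  obtain ⟨e⟩ : Nonempty (S ≃ (Sᶜ : Set ℕ)) := nonempty_equiv_of_countable
  refine ⟨(Equiv.Set.sumCompl S).symm.trans ((Equiv.sumCongr e e.symm).trans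
    ((Equiv.sumComm _ _).trans (Equiv.Set.sumCompl S))), fun n hn => ?_⟩
  simp [Equiv.Set.sumCompl_symm_apply_of_notMem hn]

/-- The vectors supported on `S`. -/
def supported (E : HilbertBasis ℕ ℂ H) (S : Set ℕ) : Submodule ℂ H where
  carrier := {x | ∀ n, n ∉ S → ⟪E n, x⟫_ℂ = 0}
  add_mem' hx hy n hn := by rw [inner_add_right, hx n hn, hy n hn, add_zero]
  zero_mem' n _ := inner_zero_right _
  smul_mem' c x hx n hn := by rw [inner_smul_right, hx n hn, mul_zero]

theorem mem_supported {E : HilbertBasis ℕ ℂ H} {S : Set ℕ} {x : H} :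
    x ∈ supported E S ↔ ∀ n, n ∉ S → ⟪E n, x⟫_ℂ = 0 := Iff.rfl

theorem isClosed_supported (E : HilbertBasis ℕ ℂ H) (S : Set ℕ) :
    IsClosed (supported E S : Set H) := by
  have h : (supported E S : Set H) = ⋂ n, ⋂ (_ : n ∉ S), {x | ⟪E n, x⟫_ℂ = 0} := by
    ext x
    simp [mem_supported]
  rw [h]
  exact isClosed_iInter fun n => isClosed_iInter fun _ =>
    isClosed_eq (continuous_const.inner continuous_id) continuous_const

instance (E : HilbertBasis ℕ ℂ H) (S : Set ℕ) : CompleteSpace (supported E S) :=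
  (isClosed_supported E S).completeSpace_coe

theorem inner_eq_zero_of_mem_supported_orthogonal {E : HilbertBasis ℕ ℂ H} {S : Set ℕ} {x : H}
    (hx : x ∈ (supported E S)ᗮ) {n : ℕ} (hn : n ∈ S) : ⟪E n, x⟫_ℂ = 0 := by
  refine hx (E n) fun k hk => ?_
  rw [orthonormal_iff_ite.1 E.orthonormal, if_neg]
  rintro rfl
  exact hk hn

theorem inner_eq_zero_of_supported {E : HilbertBasis ℕ ℂ H} {S T : Set ℕ} (hST : Disjoint S T)
    {x y : H} (hx : x ∈ supported E S) (hy : y ∈ supported E T) : ⟪x, y⟫_ℂ = 0 := by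
  rw [← E.tsum_inner_mul_inner x y]
  refine (tsum_congr fun n => ?_).trans tsum_zero
  by_cases hn : n ∈ S
  · rw [hy n (Set.disjoint_left.1 hST hn), mul_zero]
  · rw [← inner_conj_symm, hx n hn, map_zero, zero_mul]

theorem permUnitary_mem_supported {E : HilbertBasis ℕ ℂ H} {S : Set ℕ} {ρ : Equiv.Perm ℕ}
    (hρ : ∀ n, n ∉ S → ρ n ∈ S) {x : H} (hx : x ∈ (supported E S)ᗮ) :
    permUnitary E ρ x ∈ supported E S := by
  intro k hk
  obtain ⟨n, rfl⟩ := ρ.surjective k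
  rw [← permUnitary_apply, LinearIsometryEquiv.inner_map_map]
  exact inner_eq_zero_of_mem_supported_orthogonal hx (not_not.1 fun hn => hk (hρ n hn))

/-- The part of `x` off `S` is carried into the vectors supported on `S`, where only the projection
of `y` is seen. -/
theorem norm_inner_permUnitary_le {E : HilbertBasis ℕ ℂ H} {S : Set ℕ} {ρ : Equiv.Perm ℕ}
    (hρ : ∀ n, n ∉ S → ρ n ∈ S) (x y : H) :
    ‖⟪y, permUnitary E ρ x⟫_ℂ‖ ≤ ‖y‖ * ‖(supported E S).starProjection x‖ +
      ‖(supported E S).starProjection y‖ * ‖x‖ := by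
  set K := supported E S
  have hx : x - K.starProjection x ∈ Kᗮ := K.sub_starProjection_mem_orthogonal x
  have hy : y - K.starProjection y ∈ Kᗮ := K.sub_starProjection_mem_orthogonal y
  have h1 : ⟪y, permUnitary E ρ x⟫_ℂ = ⟪y, permUnitary E ρ (K.starProjection x)⟫_ℂ +
      ⟪K.starProjection y, permUnitary E ρ (x - K.starProjection x)⟫_ℂ := by
    have h2 := Submodule.inner_left_of_mem_orthogonal (permUnitary_mem_supported hρ hx) hy
    rw [inner_sub_left, sub_eq_zero] at h2
    rw [← h2, ← inner_add_right, ← map_add, add_sub_cancel]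
  have h3 : ‖x - K.starProjection x‖ ≤ ‖x‖ := by
    rw [← Submodule.starProjection_orthogonal_val]
    exact Kᗮ.norm_starProjection_apply_le x
  rw [h1]
  refine (norm_add_le _ _).trans (add_le_add ?_ ?_)
  · simpa using norm_inner_le_norm (𝕜 := ℂ) y (permUnitary E ρ (K.starProjection x))
  · refine (norm_inner_le_norm _ _).trans ?_
    rw [LinearIsometryEquiv.norm_map]
    exact mul_le_mul_of_nonneg_left h3 (norm_nonneg _)

theorem sum_norm_sq_starProjection_le {E : HilbertBasis ℕ ℂ H} {ι : Type*} [Fintype ι]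
    {S : ι → Set ℕ} (hS : Pairwise fun i j => Disjoint (S i) (S j)) (x : H) :
    ∑ i, ‖(supported E (S i)).starProjection x‖ ^ 2 ≤ ‖x‖ ^ 2 := by
  classical
  set p : ι → H := fun i => (supported E (S i)).starProjection x with hp
  have hmem : ∀ i, p i ∈ supported E (S i) := fun i => Submodule.starProjection_apply_mem _ x
  have hpx : ∀ i, ⟪p i, x⟫_ℂ = (‖p i‖ ^ 2 : ℝ) := fun i => by
    have h := Submodule.inner_right_of_mem_orthogonal (hmem i)
      ((supported E (S i)).sub_starProjection_mem_orthogonal x)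
    rw [inner_sub_right, sub_eq_zero] at h
    rw [h, inner_self_eq_norm_sq_to_K]
    norm_cast
  have hpp : ∀ i j, i ≠ j → ⟪p i, p j⟫_ℂ = 0 := fun i j hij =>
    inner_eq_zero_of_supported (hS hij) (hmem i) (hmem j)
  have h1 : ⟪∑ i, p i, x⟫_ℂ = (∑ i, ‖p i‖ ^ 2 : ℝ) := by
    rw [sum_inner, Complex.ofReal_sum]
    exact Finset.sum_congr rfl fun i _ => hpx i
  have h2 : ⟪∑ i, p i, ∑ i, p i⟫_ℂ = (∑ i, ‖p i‖ ^ 2 : ℝ) := by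
    rw [sum_inner, Complex.ofReal_sum]
    refine Finset.sum_congr rfl fun i _ => ?_
    rw [inner_sum, Finset.sum_eq_single i (fun j _ hj => hpp i j hj.symm) (by simp),
      inner_self_eq_norm_sq_to_K]
    norm_cast
  have h3 : ‖∑ i, p i‖ ^ 2 = ∑ i, ‖p i‖ ^ 2 := by
    rw [inner_self_eq_norm_sq_to_K] at h2
    exact Complex.ofReal_injective ((Complex.ofReal_pow _ _).trans h2)
  have h4 : ∑ i, ‖p i‖ ^ 2 ≤ ‖∑ i, p i‖ * ‖x‖ := by
    have h := norm_inner_le_norm (𝕜 := ℂ) (∑ i, p i) x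
    rwa [h1, Complex.norm_real, Real.norm_of_nonneg (by positivity)] at h
  -- With p the sum of the projections, ‖p‖² ≤ ‖p‖‖x‖ ≤ (‖p‖² + ‖x‖²)/2, which avoids dividing by
  -- ‖p‖.
  nlinarith [sq_nonneg (‖∑ i, p i‖ - ‖x‖), norm_nonneg (∑ i, p i), norm_nonneg x]

theorem sum_norm_starProjection_le {E : HilbertBasis ℕ ℂ H} {m : ℕ}
    {S : Fin m → Set ℕ} (hS : Pairwise fun i j => Disjoint (S i) (S j)) (x : H) :
    ∑ i, ‖(supported E (S i)).starProjection x‖ ≤ √m * ‖x‖ := by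
  refine abs_le_of_sq_le_sq' ?_ (by positivity) |>.2
  rw [mul_pow, Real.sq_sqrt (Nat.cast_nonneg m)]
  calc _ ≤ (m : ℝ) * ∑ i, ‖(supported E (S i)).starProjection x‖ ^ 2 := by
        simpa using sq_sum_le_card_mul_sum_sq (s := Finset.univ)
          (f := fun i => ‖(supported E (S i)).starProjection x‖)
    _ ≤ _ := mul_le_mul_of_nonneg_left (sum_norm_sq_starProjection_le hS x) (Nat.cast_nonneg m)

/-- The image `y` of `x` is paired with itself. Cauchy-Schwarz over the disjoint supports costs √m
once for the projections of `x` and once for those of `y`. -/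
theorem norm_sum_permUnitary_le {E : HilbertBasis ℕ ℂ H} {m : ℕ} {S : Fin m → Set ℕ}
    (hS : Pairwise fun i j => Disjoint (S i) (S j)) {ρ : Fin m → Equiv.Perm ℕ}
    (hρ : ∀ i n, n ∉ S i → ρ i n ∈ S i) :
    ‖∑ i, ((permUnitary E (ρ i)).toContinuousLinearEquiv : H →L[ℂ] H)‖ ≤ 2 * √m := by
  refine ContinuousLinearMap.opNorm_le_bound _ (by positivity) fun x => ?_
  set y : H := (∑ i, ((permUnitary E (ρ i)).toContinuousLinearEquiv : H →L[ℂ] H)) x with hy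
  have hy' : y = ∑ i, permUnitary E (ρ i) x := by
    rw [hy, _root_.sum_apply]
    rfl
  have h : ‖y‖ * ‖y‖ ≤ 2 * √m * ‖x‖ * ‖y‖ := by
    calc ‖y‖ * ‖y‖ = ‖⟪y, y⟫_ℂ‖ := by
          rw [inner_self_eq_norm_sq_to_K, norm_pow, sq, RCLike.norm_ofReal, abs_norm]
      _ = ‖∑ i, ⟪y, permUnitary E (ρ i) x⟫_ℂ‖ := by rw [← inner_sum, ← hy']
      _ ≤ ∑ i, (‖y‖ * ‖(supported E (S i)).starProjection x‖ +
            ‖(supported E (S i)).starProjection y‖ * ‖x‖) :=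
          norm_sum_le_of_le _ fun i _ => norm_inner_permUnitary_le (hρ i) x y
      _ = ‖y‖ * ∑ i, ‖(supported E (S i)).starProjection x‖ +
            (∑ i, ‖(supported E (S i)).starProjection y‖) * ‖x‖ := by
          rw [Finset.sum_add_distrib, Finset.mul_sum, Finset.sum_mul]
      _ ≤ ‖y‖ * (√m * ‖x‖) + (√m * ‖y‖) * ‖x‖ := by
          gcongr
          exacts [sum_norm_starProjection_le hS x, sum_norm_starProjection_le hS y]
      _ = 2 * √m * ‖x‖ * ‖y‖ := by ring
  rcases (norm_nonneg y).eq_or_lt with h0 | h0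
  · rw [← h0]
    positivity
  · exact le_of_mul_le_mul_right h h0

theorem infinite_setOf_mod_eq {m i : ℕ} (hi : i < m) : {n : ℕ | n % m = i}.Infinite :=
  Set.infinite_of_injective_forall_mem (f := fun k => m * k + i)
    (fun k l h => by
      have : m * k = m * l := Nat.add_right_cancel h
      exact Nat.eq_of_mul_eq_mul_left (by omega) this)
    fun k => by simp [Nat.mod_eq_of_lt hi]

theorem exists_mem_convexHull_norm_le (E : HilbertBasis ℕ ℂ H) {m : ℕ} (hm : 2 ≤ m) :
    ∃ c ∈ convexHull ℝ (permMatrices E), ‖c‖ ≤ 2 / √m := by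
  let S : Fin m → Set ℕ := fun i => {n | n % m = i}
  have hS : Pairwise fun i j => Disjoint (S i) (S j) := fun i j hij =>
    Set.disjoint_left.2 fun n hi hj => hij (Fin.ext (Eq.trans (Eq.symm hi) hj))
  have hex : ∀ i, ∃ ρ : Equiv.Perm ℕ, ∀ n, n ∉ S i → ρ n ∈ S i := fun i => by
    -- A second residue class makes the complement of `S i` infinite, whence `2 ≤ m`.
    have : Nontrivial (Fin m) := Fin.nontrivial_iff_two_le.2 hm
    obtain ⟨j, hj⟩ := exists_ne i
    exact exists_perm_mapsTo_compl (infinite_setOf_mod_eq i.2)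
      ((infinite_setOf_mod_eq j.2).mono (Set.subset_compl_iff_disjoint_right.2 (hS hj)))
  choose ρ hρ using hex
  have hm0 : (0 : ℝ) < m := by exact_mod_cast (by omega : 0 < m)
  refine ⟨∑ i : Fin m, (m : ℝ)⁻¹ • ((permUnitary E (ρ i)).toContinuousLinearEquiv : H →L[ℂ] H),
    (convex_convexHull ℝ _).sum_mem (fun i _ => by positivity) (by simp [hm0.ne'])
      (fun i _ => subset_convexHull ℝ _ ⟨_, rfl⟩), ?_⟩
  rw [← Finset.smul_sum, norm_smul, norm_inv, Real.norm_of_nonneg hm0.le]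
  refine (mul_le_mul_of_nonneg_left (norm_sum_permUnitary_le hS hρ) (by positivity)).trans_eq ?_
  rw [inv_mul_eq_div, div_eq_div_iff hm0.ne' (by positivity), mul_assoc, Real.mul_self_sqrt hm0.le]

theorem zero_mem_closure_convexHull (E : HilbertBasis ℕ ℂ H) :
    (0 : H →L[ℂ] H) ∈ closure (convexHull ℝ (permMatrices E)) := by
  rw [Metric.mem_closure_iff]
  intro ε hε
  have hlim : Filter.Tendsto (fun m : ℕ => 2 / √(m : ℝ)) Filter.atTop (𝓝 0) :=
    tendsto_const_nhds.div_atTop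
      (Real.tendsto_sqrt_atTop.comp tendsto_natCast_atTop_atTop)
  obtain ⟨m, hm, hm2⟩ := ((hlim.eventually_lt_const hε).and
    (Filter.eventually_ge_atTop 2)).exists
  obtain ⟨c, hc, hcm⟩ := exists_mem_convexHull_norm_le E hm2
  exact ⟨c, hc, by simpa using hcm.trans_lt hm⟩

theorem zero_notMem_DS (E : HilbertBasis ℕ ℂ H) : (0 : H →L[ℂ] H) ∉ DS E := fun h => by
  have h1 := h.2.1 0
  simp only [coeff, _root_.zero_apply, inner_zero_right] at h1
  exact zero_ne_one (hasSum_zero.unique h1)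

theorem zero_mem_DSS (E : HilbertBasis ℕ ℂ H) : (0 : H →L[ℂ] H) ∈ DSS E := by
  rw [mem_DSS_iff]
  simp [coeff]

variable (H) in
theorem normTopology_le_weakBanachTopology : normTopology H ≤ weakBanachTopology H :=
  continuous_iff_le_induced.1 (toWeakSpaceCLM ℂ (H →L[ℂ] H)).continuous

end BirkhoffHull

end

open BirkhoffHull in
/-- The last part covers every topology between the weak and the Arens-Mackey one
(in Mathlib `τ₁ ≤ τ₂` means that `τ₁` is finer than `τ₂`). -/
theorem mainTheorem2 {H : Type*} [NormedAddCommGroup H] [InnerProductSpace ℂ H] [CompleteSpace H]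
    (E : HilbertBasis ℕ ℂ H) :
    (∀ τ ∈ operatorTopologies H, closedHull τ (permMatrices E) ≠ DS E) ∧
    (∀ τ ∈ weakToMackeyTopologies H, closedHull τ (permMatrices E) = DSS E) ∧
    (∀ τ : TopologicalSpace (H →L[ℂ] H), mackeyTopology H ≤ τ → τ ≤ weakTopology H →
      closedHull τ (permMatrices E) = DSS E) := by
  have hDSS : ∀ τ ∈ weakToMackeyTopologies H, closedHull τ (permMatrices E) = DSS E :=
    fun τ hτ => have h := between_of_mem_weakToMackeyTopologies hτ
      closedHull_permMatrices_eq_DSS E h.1 h.2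
  refine ⟨fun τ hτ h => zero_notMem_DS E ?_, hDSS,
    fun τ h1 h2 => closedHull_permMatrices_eq_DSS E h1 h2⟩
  rw [← h]
  -- Zero separates the hull from `DS`: it lies in `DSS` for the first seven topologies, and is a
  -- norm limit for the other two.
  rcases hτ with hτ | rfl | rfl
  · rw [hDSS τ hτ]
    exact zero_mem_DSS E
  · exact closure.mono (normTopology_le_weakBanachTopology H) (zero_mem_closure_convexHull E)
  · exact zero_mem_closure_convexHull E
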